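/- Let $3\le d_1<d_2<d_3$ be integers with $\gcd(d_1,d_2,d_3)=1$, none of which is a non-negative integer combination of the other two, and let $S_3=\langle d_1,d_2,d_3\rangle$ be the numerical semigroup they generate. Let $\Delta_3=\mathbb Z_{>0}\setminus S_3$ be its (finite) set of gaps, $F_3=\max\Delta_3$, $G_r=\sum_{s\in\Delta_3}s^r$, $\sigma_k=d_1^k+d_2^k+d_3^k$, $\delta_k=(\sigma_k-1)/2^k$, $\pi_3=d_1d_2d_3$ and $g_3=F_3+\sigma_1$. Put $$K_0=G_0+\delta_1,\qquad K_1=G_1+\tfrac{\sigma_1}{2}G_0+\tfrac{3\delta_1^2+\delta_2}{6},$$ $$K_3=G_3+\tfrac{3\sigma_1}{2}G_2+\tfrac{3\sigma_1^2+\sigma_2}{4}G_1+\tfrac{\sigma_1(\sigma_1^2+\sigma_2)}{8}G_0+\tfrac{15\delta_1^4+30\delta_1^2\delta_2+5\delta_2^2-2\delta_4}{60},$$ and define the rescaled quantities $h_r=K_r/g_3^{\,r+1}$ for $r=0,1,3$, and $v=\pi_3/g_3^2$. Then there are integers $0\le x_1,x_2,x_3,y<g_3$ (degrees of syzygies) such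 that $$(1-t^{d_1})(1-t^{d_2})(1-t^{d_3})\sum_{s\in S_3}t^s=1-t^{x_1}-t^{x_2}-t^{x_3}+t^{y}+t^{g_3},$$ and for every such choice of $x_1,x_2,x_3,y$, with $u=(y+g_3)/g_3$ and $\Delta_1=\tfrac12(2h_0-1)(u-1-2h_0)$, one has $\Delta_1=3h_1-2h_0^2+\tfrac v4$ and $$10h_3=18h_1^2-vh_0^2+\frac{v^2}{24}+u^2\Delta_1 .$$ Moreover, for all such semigroups $S_3$, $$0.02443<h_3<0.07515 .$$ -/

import Mathlib

/-- The numerical semigroup `⟨d₁, d₂, d₃⟩`: all natural numbers of the form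
`a d₁ + b d₂ + c d₃` with `a, b, c ∈ ℕ`. -/
def semigroup3 (d₁ d₂ d₃ : ℕ) : AddSubmonoid ℕ :=
  AddSubmonoid.closure {d₁, d₂, d₃}

/-- `d₁, d₂, d₃`, listed increasingly, is the minimal generating system of a numerical
semigroup: the gcd is one and no generator is a combination of the other two. -/
structure IsMinGenTriple (d₁ d₂ d₃ : ℕ) : Prop where
  gcd_eq_one : Nat.gcd (Nat.gcd d₁ d₂) d₃ = 1
  three_le : 3 ≤ d₁
  lt_left : d₁ < d₂
  lt_right : d₂ < d₃
  min_left : d₁ ∉ AddSubmonoid.closure ({d₂, d₃} : Set ℕ)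
  min_mid : d₂ ∉ AddSubmonoid.closure ({d₁, d₃} : Set ℕ)
  min_right : d₃ ∉ AddSubmonoid.closure ({d₁, d₂} : Set ℕ)

/-- The set of gaps. (As `0` lies in the semigroup, all gaps are positive.) -/
def gaps3 (d₁ d₂ d₃ : ℕ) : Set ℕ := {s | s ∉ semigroup3 d₁ d₂ d₃}

/-- The Frobenius number: the largest gap. -/
noncomputable def frobenius3 (d₁ d₂ d₃ : ℕ) : ℕ := sSup (gaps3 d₁ d₂ d₃)

/-- For the triples considered here, `frobenius3` is indeed the largest gap. -/
theorem IsMinGenTriple.isGreatest_frobenius3 {d₁ d₂ d₃ : ℕ} (h : IsMinGenTriple d₁ d₂ d₃) :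
    IsGreatest (gaps3 d₁ d₂ d₃) (frobenius3 d₁ d₂ d₃) := by
  obtain ⟨n, hn⟩ : ∃ n, FrobeniusNumber n ({d₁, d₂, d₃} : Set ℕ) := by
    rw [exists_frobeniusNumber_iff]
    have hl := h.three_le
    have h1 := h.lt_left
    have h2 := h.lt_right
    refine ⟨?_, ?_⟩
    · rw [← Nat.dvd_one, ← h.gcd_eq_one]
      exact Nat.dvd_gcd (Nat.dvd_gcd (Nat.setGcd_dvd_of_mem (by simp))
        (Nat.setGcd_dvd_of_mem (by simp))) (Nat.setGcd_dvd_of_mem (by simp))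
    · simp only [Set.mem_insert_iff, Set.mem_singleton_iff]
      omega
  have hg : IsGreatest (gaps3 d₁ d₂ d₃) n := hn
  have he : frobenius3 d₁ d₂ d₃ = n := hg.csSup_eq
  rw [he]
  exact hg

/-- There are only finitely many gaps, so the sums over gaps below are honest finite sums. -/
theorem IsMinGenTriple.finite_gaps3 {d₁ d₂ d₃ : ℕ} (h : IsMinGenTriple d₁ d₂ d₃) :
    (gaps3 d₁ d₂ d₃).Finite :=
  (Set.finite_Iic (frobenius3 d₁ d₂ d₃)).subset fun _ hs => h.isGreatest_frobenius3.2 hs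

/-- The largest syzygy degree `g₃ = F₃ + d₁ + d₂ + d₃`. -/
noncomputable def largestSyzygyDegree (d₁ d₂ d₃ : ℕ) : ℕ :=
  frobenius3 d₁ d₂ d₃ + (d₁ + d₂ + d₃)

open Classical in
/-- The Hilbert series `∑_{s ∈ S} t ^ s` of the semigroup, as a formal power series. -/
noncomputable def hilbertSeries3 (d₁ d₂ d₃ : ℕ) : PowerSeries ℤ :=
  PowerSeries.mk fun s => if s ∈ semigroup3 d₁ d₂ d₃ then 1 else 0

/-- `x₁, x₂, x₃, y` and `g₃` are the degrees of syzygies: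
`H(t) (1 - t^d₁) (1 - t^d₂) (1 - t^d₃) = 1 - t^x₁ - t^x₂ - t^x₃ + t^y + t^g₃`,
where `g₃` is larger than the four other degrees. If the semigroup is symmetric, one of the
`xⱼ` equals `y`, the two terms cancel, and their common value is irrelevant. -/
structure IsSyzygyDegrees (d₁ d₂ d₃ x₁ x₂ x₃ y : ℕ) : Prop where
  hilbert_eq :
    hilbertSeries3 d₁ d₂ d₃ *
        ((1 - PowerSeries.X ^ d₁) * (1 - PowerSeries.X ^ d₂) * (1 - PowerSeries.X ^ d₃)) =
      1 - PowerSeries.X ^ x₁ - PowerSeries.X ^ x₂ - PowerSeries.X ^ x₃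
        + PowerSeries.X ^ y + PowerSeries.X ^ largestSyzygyDegree d₁ d₂ d₃
  x₁_lt : x₁ < largestSyzygyDegree d₁ d₂ d₃
  x₂_lt : x₂ < largestSyzygyDegree d₁ d₂ d₃
  x₃_lt : x₃ < largestSyzygyDegree d₁ d₂ d₃
  y_lt : y < largestSyzygyDegree d₁ d₂ d₃

/-- The genera `G_r = ∑ s ^ r`, the sum being over all gaps `s`. -/
noncomputable def genus3 (r d₁ d₂ d₃ : ℕ) : ℝ := ∑ᶠ s ∈ gaps3 d₁ d₂ d₃, (s : ℝ) ^ r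

/-- The power sums `σ_k = d₁ ^ k + d₂ ^ k + d₃ ^ k`. -/
def sigma3 (k d₁ d₂ d₃ : ℕ) : ℝ := (d₁ : ℝ) ^ k + (d₂ : ℝ) ^ k + (d₃ : ℝ) ^ k

/-- `δ_k = (σ_k - 1) / 2 ^ k`. -/
noncomputable def delta3 (k d₁ d₂ d₃ : ℕ) : ℝ := (sigma3 k d₁ d₂ d₃ - 1) / 2 ^ k

/-- `K₀ = G₀ + δ₁`. -/
noncomputable def coeffK0 (d₁ d₂ d₃ : ℕ) : ℝ := genus3 0 d₁ d₂ d₃ + delta3 1 d₁ d₂ d₃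

/-- `K₁ = G₁ + (σ₁ / 2) G₀ + (3 δ₁² + δ₂) / 6`. -/
noncomputable def coeffK1 (d₁ d₂ d₃ : ℕ) : ℝ :=
  genus3 1 d₁ d₂ d₃ + sigma3 1 d₁ d₂ d₃ / 2 * genus3 0 d₁ d₂ d₃
    + (3 * delta3 1 d₁ d₂ d₃ ^ 2 + delta3 2 d₁ d₂ d₃) / 6

/-- `K₃ = G₃ + 3 T₁(σ) G₂ + 3 T₂(σ) G₁ + T₃(σ) G₀ + (2⁴ / 4) T₄(δ)`, the case `p = 3` of
`K_p = ∑_{r ≤ p} (p choose r) T_{p-r}(σ) G_r + (2^{p+1} / (p+1)) T_{p+1}(δ)`. Here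
`T₁(a) = a₁ / 2`, `T₂(a) = (3 a₁² + a₂) / 12`, `T₃(a) = a₁ (a₁² + a₂) / 8` and
`T₄(a) = (15 a₁⁴ + 30 a₁² a₂ + 5 a₂² - 2 a₄) / 240`. -/
noncomputable def coeffK3 (d₁ d₂ d₃ : ℕ) : ℝ :=
  genus3 3 d₁ d₂ d₃
    + 3 * sigma3 1 d₁ d₂ d₃ / 2 * genus3 2 d₁ d₂ d₃
    + (3 * sigma3 1 d₁ d₂ d₃ ^ 2 + sigma3 2 d₁ d₂ d₃) / 4 * genus3 1 d₁ d₂ d₃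
    + sigma3 1 d₁ d₂ d₃ * (sigma3 1 d₁ d₂ d₃ ^ 2 + sigma3 2 d₁ d₂ d₃) / 8 * genus3 0 d₁ d₂ d₃
    + (15 * delta3 1 d₁ d₂ d₃ ^ 4 + 30 * delta3 1 d₁ d₂ d₃ ^ 2 * delta3 2 d₁ d₂ d₃
        + 5 * delta3 2 d₁ d₂ d₃ ^ 2 - 2 * delta3 4 d₁ d₂ d₃) / 60

/-- `h₀ = K₀ / g₃`. -/
noncomputable def rescaledGenus0 (d₁ d₂ d₃ : ℕ) : ℝ :=
  coeffK0 d₁ d₂ d₃ / (largestSyzygyDegree d₁ d₂ d₃ : ℝ)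

/-- `h₁ = K₁ / g₃ ^ 2`. -/
noncomputable def rescaledGenus1 (d₁ d₂ d₃ : ℕ) : ℝ :=
  coeffK1 d₁ d₂ d₃ / (largestSyzygyDegree d₁ d₂ d₃ : ℝ) ^ 2

/-- `h₃ = K₃ / g₃ ^ 4`. -/
noncomputable def rescaledGenus3 (d₁ d₂ d₃ : ℕ) : ℝ :=
  coeffK3 d₁ d₂ d₃ / (largestSyzygyDegree d₁ d₂ d₃ : ℝ) ^ 4

/-- `v = d₁ d₂ d₃ / g₃ ^ 2`. -/
noncomputable def rescaledProd (d₁ d₂ d₃ : ℕ) : ℝ :=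
  ((d₁ : ℝ) * d₂ * d₃) / (largestSyzygyDegree d₁ d₂ d₃ : ℝ) ^ 2

/-- `u = (y + g₃) / g₃`, for a syzygy degree `y`. -/
noncomputable def syzygyRatio (d₁ d₂ d₃ y : ℕ) : ℝ :=
  ((y : ℝ) + largestSyzygyDegree d₁ d₂ d₃) / largestSyzygyDegree d₁ d₂ d₃

/-- `Δ₁ = (2 h₀ - 1) (u - 1 - 2 h₀) / 2`. -/
noncomputable def Delta1 (d₁ d₂ d₃ y : ℕ) : ℝ :=
  1 / 2 * (2 * rescaledGenus0 d₁ d₂ d₃ - 1) *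
    (syzygyRatio d₁ d₂ d₃ y - 1 - 2 * rescaledGenus0 d₁ d₂ d₃)

/-! Choosing in each residue class modulo `d₁` the least `p d₂ + q d₃`, with a fixed tie-break,
identifies the Apéry set with a set of pairs closed downwards in `ℕ²`. Its complement within the
bounding box has at most one minimal element, so the set is a rectangle or an L-shape
(`IsNormalPair.shape`). Summing geometric series over it gives the numerator of the Hilbert series,
and its outer corners give the Frobenius number (`exists_isSyzygyDegrees`).

Putting `t = exp X` and comparing coefficients up to degree six expresses the power sums of the
syzygy degrees through `π₃`, `K₀`, `K₁`, `K₃` (`IsSyzygyDegrees.power_sums`). Since there are only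
three `xⱼ`, their fourth and sixth power sums are polynomials in the first three, which gives both
identities (`degree_four_relation`, `degree_six_relation`).

For the bounds, `120 π₃ K₃` is a sextic form in the side lengths of the shape. It lies strictly
between `3 π₃ g₃⁴` and `9 π₃ g₃⁴`, because the differences have nonnegative coefficients in suitable
variables (`rectangle_bounds`, `lshape_bounds`). Hence `1/40 < h₃ < 3/40`, slightly more than
needed. -/

/-! ### Normal pairs and the shape of their set. -/

/-- The pair `(p, q)` is the representation of least value `p b + q c` of its residue class
modulo `a`, ties being broken in favour of the smaller first coordinate. -/
def IsNormalPair (a b c p q : ℕ) : Prop :=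
  ∀ p' q', p' * b + q' * c ≡ p * b + q * c [MOD a] →
    p * b + q * c < p' * b + q' * c ∨ (p * b + q * c = p' * b + q' * c ∧ p ≤ p')

namespace IsNormalPair

variable {a b c : ℕ}

theorem unique (hc : 0 < c) {p q p' q' : ℕ} (h : IsNormalPair a b c p q)
    (h' : IsNormalPair a b c p' q') (e : p * b + q * c ≡ p' * b + q' * c [MOD a]) :
    p = p' ∧ q = q' := by
  have h1 := h p' q' e.symm
  have h2 := h' p q e
  have hp : p = p' := by omega
  subst hp
  have : q * c = q' * c := by omega
  exact ⟨rfl, Nat.eq_of_mul_eq_mul_right hc this⟩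

theorem exists_modEq (n p q : ℕ) (hn : p * b + q * c ≡ n [MOD a]) :
    ∃ p' q', IsNormalPair a b c p' q' ∧ p' * b + q' * c ≡ n [MOD a] := by
  classical
  have hv : ∃ v p q, p * b + q * c = v ∧ v ≡ n [MOD a] := ⟨_, p, q, rfl, hn⟩
  have hp : ∃ p q, p * b + q * c = Nat.find hv := by
    obtain ⟨p, q, e, -⟩ := Nat.find_spec hv
    exact ⟨p, q, e⟩
  obtain ⟨-, -, -, hm⟩ := Nat.find_spec hv
  obtain ⟨q₀, hq₀⟩ := Nat.find_spec hp
  refine ⟨Nat.find hp, q₀, fun p' q' e => ?_, by rw [hq₀]; exact hm⟩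
  rw [hq₀] at e ⊢
  have hle : Nat.find hv ≤ p' * b + q' * c := Nat.find_min' hv ⟨p', q', rfl, e.trans hm⟩
  rcases hle.lt_or_eq with hlt | heq
  · exact Or.inl hlt
  · exact Or.inr ⟨heq, Nat.find_min' hp ⟨q', heq.symm⟩⟩

theorem mono {p q p' q' : ℕ} (h : IsNormalPair a b c p q) (hp : p' ≤ p) (hq : q' ≤ q) :
    IsNormalPair a b c p' q' := by
  obtain ⟨i, rfl⟩ := Nat.exists_eq_add_of_le hp
  obtain ⟨j, rfl⟩ := Nat.exists_eq_add_of_le hq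
  intro r s e
  have e1 : (r + i) * b + (s + j) * c = (r * b + s * c) + (i * b + j * c) := by ring
  have e2 : (p' + i) * b + (q' + j) * c = (p' * b + q' * c) + (i * b + j * c) := by ring
  have := h (r + i) (s + j) (by rw [e1, e2]; exact e.add_right _)
  rw [e1, e2] at this
  omega

theorem zero : IsNormalPair a b c 0 0 := by
  intro p q _
  rcases Nat.eq_zero_or_pos (p * b + q * c) with h | h
  · exact Or.inr ⟨by simp [h], Nat.zero_le _⟩
  · exact Or.inl (by simpa using h)

theorem lt_left (ha : 0 < a) (hb : 0 < b) {p q : ℕ} (h : IsNormalPair a b c p q) : p < a := by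
  by_contra! hp
  have h0 := (h.mono hp (Nat.zero_le q)) 0 0 (by simp [Nat.ModEq])
  have := Nat.mul_pos ha hb
  omega

theorem lt_right (ha : 0 < a) (hc : 0 < c) {p q : ℕ} (h : IsNormalPair a b c p q) : q < a := by
  by_contra! hq
  have h0 := (h.mono (Nat.zero_le p) hq) 0 0 (by simp [Nat.ModEq])
  have := Nat.mul_pos ha hc
  omega

/-- A pair which is not normal, while both its lower neighbours are, represents zero. -/
theorem modEq_zero_of_minimal (hc : 0 < c) {r s : ℕ} (h : ¬ IsNormalPair a b c (r + 1) (s + 1))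
    (h1 : IsNormalPair a b c r (s + 1)) (h2 : IsNormalPair a b c (r + 1) s) :
    (r + 1) * b + (s + 1) * c ≡ 0 [MOD a] := by
  obtain ⟨p, q, hn, e⟩ := exists_modEq (a := a) (b := b) (c := c) _ (r + 1) (s + 1) rfl
  -- If the normal representative had a positive coordinate, cancelling one `b` or `c` would
  -- identify it with a normal neighbour of `(r + 1, s + 1)`, by uniqueness. So it is `(0, 0)`.
  rcases p with _ | p
  · rcases q with _ | q
    · simpa using e.symm
    · exfalso
      have e' : 0 * b + q * c ≡ (r + 1) * b + s * c [MOD a] := by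
        refine Nat.ModEq.add_right_cancel' c ?_
        convert e using 1 <;> ring
      have := unique hc (hn.mono le_rfl (Nat.le_succ q)) h2 e'
      omega
  · exfalso
    have e' : p * b + q * c ≡ r * b + (s + 1) * c [MOD a] := by
      refine Nat.ModEq.add_right_cancel' b ?_
      convert e using 1 <;> ring
    obtain ⟨rfl, rfl⟩ := unique hc (hn.mono (Nat.le_succ p) le_rfl) h1 e'
    exact h hn

/-- Below a non-normal pair in the rectangle there is a minimal one, and it represents zero. -/
theorem exists_minimal (hc : 0 < c) {A B : ℕ} (hA : ∀ p < A, IsNormalPair a b c p 0)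
    (hB : ∀ q < B, IsNormalPair a b c 0 q) (p q : ℕ) (hp : p < A) (hq : q < B)
    (h : ¬ IsNormalPair a b c p q) :
    ∃ r s, r + 1 ≤ p ∧ s + 1 ≤ q ∧ ¬ IsNormalPair a b c (r + 1) (s + 1) ∧
      IsNormalPair a b c r (s + 1) ∧ IsNormalPair a b c (r + 1) s ∧
      (r + 1) * b + (s + 1) * c ≡ 0 [MOD a] := by
  induction hn : p + q using Nat.strong_induction_on generalizing p q with
  | _ n ih =>
    rcases p with _ | p
    · exact absurd (hB q hq) h
    rcases q with _ | q
    · exact absurd (hA _ hp) h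
    by_cases h1 : IsNormalPair a b c p (q + 1)
    · by_cases h2 : IsNormalPair a b c (p + 1) q
      · exact ⟨p, q, le_rfl, le_rfl, h, h1, h2, modEq_zero_of_minimal hc h h1 h2⟩
      · obtain ⟨r, s, hr, hs, H⟩ := ih _ (by omega) (p + 1) q hp (by omega) h2 rfl
        exact ⟨r, s, hr, by omega, H⟩
    · obtain ⟨r, s, hr, hs, H⟩ := ih _ (by omega) p (q + 1) (by omega) hq h1 rfl
      exact ⟨r, s, by omega, hs, H⟩

/-- Subtracting two incomparable representations of zero makes a multiple of `b` congruent to a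
multiple of `c`, although both are values of normal pairs on the axes. This forces the removed
corner of the box to be unique. -/
theorem not_two_minimal (hc : 0 < c) {A B P Q r s : ℕ} (hA : ∀ p < A, IsNormalPair a b c p 0)
    (hB : ∀ q < B, IsNormalPair a b c 0 q) (hPA : P < A) (hsB : s < B) (hrP : r < P) (hQs : Q < s)
    (hPQ : P * b + Q * c ≡ 0 [MOD a]) (hrs : r * b + s * c ≡ 0 [MOD a]) : False := by
  obtain ⟨i, rfl⟩ := Nat.exists_eq_add_of_lt hrP
  obtain ⟨j, rfl⟩ := Nat.exists_eq_add_of_lt hQs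
  have e : (i + 1) * b + 0 * c ≡ 0 * b + (j + 1) * c [MOD a] := by
    refine Nat.ModEq.add_right_cancel' (r * b + Q * c) ?_
    convert hPQ.trans hrs.symm using 1 <;> ring
  have := unique hc (hA (i + 1) (by omega)) (hB (j + 1) (by omega)) e
  omega

/-- The normal pairs form a rectangle or an L-shape. -/
theorem shape (ha : 0 < a) (hb : 0 < b) (hc : 0 < c) :
    ∃ A B : ℕ, 0 < A ∧ 0 < B ∧
      ((∀ p q, IsNormalPair a b c p q ↔ p < A ∧ q < B) ∨
        ∃ P Q : ℕ, 0 < P ∧ P < A ∧ 0 < Q ∧ Q < B ∧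
          (∀ p q, IsNormalPair a b c p q ↔ p < A ∧ q < B ∧ ¬ (P ≤ p ∧ Q ≤ q)) ∧
          (B - Q) * c ≤ A * b ∧ (A - P) * b ≤ B * c) := by
  classical
  have exA : ∃ p, ¬ IsNormalPair a b c p 0 := ⟨a, fun h => lt_irrefl _ (h.lt_left ha hb)⟩
  have exB : ∃ q, ¬ IsNormalPair a b c 0 q := ⟨a, fun h => lt_irrefl _ (h.lt_right ha hc)⟩
  obtain ⟨A, hAdef⟩ : ∃ A, A = Nat.find exA := ⟨_, rfl⟩
  obtain ⟨B, hBdef⟩ : ∃ B, B = Nat.find exB := ⟨_, rfl⟩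
  have hA : ∀ p < A, IsNormalPair a b c p 0 := fun p hp => by
    rw [hAdef] at hp; exact not_not.1 (Nat.find_min exA hp)
  have hB : ∀ q < B, IsNormalPair a b c 0 q := fun q hq => by
    rw [hBdef] at hq; exact not_not.1 (Nat.find_min exB hq)
  have hA' : ¬ IsNormalPair a b c A 0 := hAdef ▸ Nat.find_spec exA
  have hB' : ¬ IsNormalPair a b c 0 B := hBdef ▸ Nat.find_spec exB
  have hA0 : 0 < A := Nat.pos_of_ne_zero fun h => hA' (by rw [h]; exact zero)
  have hB0 : 0 < B := Nat.pos_of_ne_zero fun h => hB' (by rw [h]; exact zero)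
  have hltA : ∀ p q, IsNormalPair a b c p q → p < A := fun p q h => by
    by_contra! hp; exact hA' (h.mono hp (Nat.zero_le _))
  have hltB : ∀ p q, IsNormalPair a b c p q → q < B := fun p q h => by
    by_contra! hp; exact hB' (h.mono (Nat.zero_le _) hp)
  refine ⟨A, B, hA0, hB0, ?_⟩
  by_cases hrect : ∀ p q, p < A → q < B → IsNormalPair a b c p q
  · exact Or.inl fun p q => ⟨fun h => ⟨hltA p q h, hltB p q h⟩, fun h => hrect p q h.1 h.2⟩
  right
  push Not at hrect
  obtain ⟨p₀, q₀, hp₀, hq₀, hn₀⟩ := hrect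
  obtain ⟨r, s, hr, hs, hN, hN1, hN2, e⟩ := exists_minimal hc hA hB p₀ q₀ hp₀ hq₀ hn₀
  refine ⟨r + 1, s + 1, by omega, by omega, by omega, by omega, fun p q => ?_, ?_, ?_⟩
  · refine ⟨fun h => ⟨hltA p q h, hltB p q h, fun h' => hN (h.mono h'.1 h'.2)⟩, ?_⟩
    rintro ⟨hp, hq, hpq⟩
    by_contra h
    obtain ⟨r', s', hr', hs', hN', -, -, e'⟩ := exists_minimal hc hA hB p q hp hq h
    -- A second minimal pair is incomparable to the first, or lies below one of its normal
    -- neighbours, or lies above it; the last contradicts `hpq`.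
    rcases lt_or_ge r' r with hlt | hge
    · rcases lt_or_ge s s' with hlt' | hge'
      · exact not_two_minimal hc hA hB (P := r + 1) (Q := s + 1) (r := r' + 1) (s := s' + 1)
          (by omega) (by omega) (by omega) (by omega) e e'
      · exact hN' (hN1.mono (by omega) (by omega))
    · rcases lt_or_ge s' s with hlt' | hge'
      · rcases hge.lt_or_eq with hlt | heq
        · exact not_two_minimal hc hA hB (P := r' + 1) (Q := s' + 1) (r := r + 1) (s := s + 1)
            (by omega) (by omega) (by omega) (by omega) e' e
        · exact hN' (hN2.mono (by omega) (by omega))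
      · omega
  -- The class of `A * b` has normal representative `(0, q')`, so `q' * c ≤ A * b`. As the corner
  -- represents zero, `(A - P) * b` is congruent to `(q' + Q) * c`; uniqueness then forces `q' ≥ B -
  -- Q`.
  · obtain ⟨p', q', hn, e1⟩ := exists_modEq (a := a) (b := b) (c := c) _ A 0 rfl
    obtain ⟨A', rfl⟩ := Nat.exists_eq_add_of_lt hA0
    rcases p' with _ | p'
    · have hval := hn _ _ e1.symm
      have hq : B ≤ q' + (s + 1) := by
        by_contra! hlt
        obtain ⟨i, hi⟩ := Nat.exists_eq_add_of_lt (show r + 1 < 0 + A' + 1 by omega)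
        have e2 : (i + 1) * b + 0 * c ≡ 0 * b + (q' + (s + 1)) * c [MOD a] := by
          refine Nat.ModEq.add_right_cancel' ((r + 1) * b) ?_
          have h3 := (e1.symm).trans (e.symm.add_left (0 * b + q' * c))
          rw [hi] at h3
          convert h3 using 1 <;> ring
        have := unique hc (hA (i + 1) (by omega)) (hB _ hlt) e2
        omega
      have : (B - (s + 1)) * c ≤ q' * c := Nat.mul_le_mul_right _ (by omega)
      simp only [zero_mul, zero_add, add_zero] at hval ⊢
      omega
    · exfalso
      have e' : p' * b + q' * c ≡ A' * b + 0 * c [MOD a] := by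
        refine Nat.ModEq.add_right_cancel' b ?_
        convert e1 using 1 <;> ring
      obtain ⟨rfl, rfl⟩ := unique hc (hn.mono (Nat.le_succ p') le_rfl) (hA A' (by omega)) e'
      rw [zero_add] at hA'
      exact hA' hn
  · obtain ⟨p', q', hn, e1⟩ := exists_modEq (a := a) (b := b) (c := c) _ 0 B rfl
    obtain ⟨B', rfl⟩ := Nat.exists_eq_add_of_lt hB0
    rcases q' with _ | q'
    · have hval := hn _ _ e1.symm
      have hq : A ≤ p' + (r + 1) := by
        by_contra! hlt
        obtain ⟨i, hi⟩ := Nat.exists_eq_add_of_lt (show s + 1 < 0 + B' + 1 by omega)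
        have e2 : (p' + (r + 1)) * b + 0 * c ≡ 0 * b + (i + 1) * c [MOD a] := by
          refine Nat.ModEq.add_right_cancel' ((s + 1) * c) ?_
          have h3 := (e.add_left (p' * b + 0 * c)).trans e1
          rw [hi] at h3
          convert h3 using 1 <;> ring
        have := unique hc (hA _ hlt) (hB (i + 1) (by omega)) e2
        omega
      have : (A - (r + 1)) * b ≤ p' * b := Nat.mul_le_mul_right _ (by omega)
      simp only [zero_mul, zero_add, add_zero] at hval ⊢
      omega
    · exfalso
      have e' : p' * b + q' * c ≡ 0 * b + B' * c [MOD a] := by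
        refine Nat.ModEq.add_right_cancel' c ?_
        convert e1 using 1 <;> ring
      obtain ⟨rfl, rfl⟩ := unique hc (hn.mono le_rfl (Nat.le_succ q')) (hB B' (by omega)) e'
      rw [zero_add] at hB'
      exact hB' hn

end IsNormalPair

/-! ### The Apéry set and the numerator of the Hilbert series. -/

theorem mem_semigroup3_iff {a b c n : ℕ} :
    n ∈ semigroup3 a b c ↔ ∃ k p q : ℕ, n = k * a + (p * b + q * c) := by
  have : ({a, b, c} : Set ℕ) = {a} ∪ {b, c} := Set.insert_eq a {b, c}
  rw [semigroup3, this, AddSubmonoid.closure_union, AddSubmonoid.mem_sup]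
  simp only [AddSubmonoid.mem_closure_singleton, AddSubmonoid.mem_closure_pair, smul_eq_mul]
  constructor
  · rintro ⟨_, ⟨k, rfl⟩, _, ⟨p, q, rfl⟩, rfl⟩
    exact ⟨k, p, q, rfl⟩
  · rintro ⟨k, p, q, rfl⟩
    exact ⟨_, ⟨k, rfl⟩, _, ⟨p, q, rfl⟩, rfl⟩

/-- The values of normal pairs are the elements of the Apéry set. -/
theorem apery_iff {a b c : ℕ} (ha : 0 < a) {n : ℕ} :
    (n ∈ semigroup3 a b c ∧ ¬ (a ≤ n ∧ n - a ∈ semigroup3 a b c)) ↔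
      ∃ p q, IsNormalPair a b c p q ∧ n = p * b + q * c := by
  constructor
  · rintro ⟨hn, hna⟩
    obtain ⟨k, p, q, rfl⟩ := mem_semigroup3_iff.1 hn
    obtain ⟨p', q', h, e⟩ := IsNormalPair.exists_modEq (a := a) (b := b) (c := c)
      (k * a + (p * b + q * c)) p q (by simp [Nat.ModEq])
    refine ⟨p', q', h, ?_⟩
    have hle : p' * b + q' * c ≤ k * a + (p * b + q * c) := by
      have := h p q (by refine Nat.ModEq.trans ?_ e.symm; simp [Nat.ModEq])
      omega
    obtain ⟨j, hj⟩ := (Nat.modEq_iff_dvd' hle).1 e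
    rcases j with _ | j
    · rw [mul_zero] at hj
      omega
    · have hja : a * (j + 1) = j * a + a := by ring
      exact absurd ⟨by omega, mem_semigroup3_iff.2 ⟨j, p', q', by omega⟩⟩ hna
  · rintro ⟨p, q, h, rfl⟩
    refine ⟨mem_semigroup3_iff.2 ⟨0, p, q, by simp⟩, ?_⟩
    rintro ⟨hle, hmem⟩
    obtain ⟨k, p', q', e⟩ := mem_semigroup3_iff.1 hmem
    have e' : p * b + q * c = (k + 1) * a + (p' * b + q' * c) := by
      rw [add_mul, one_mul]
      omega
    have := h p' q' (by rw [e']; simp [Nat.ModEq])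
    have hpos : 0 < (k + 1) * a := by positivity
    omega

/-- The factor `1 - X ^ a` leaves the indicator series of the Apéry set, and uniqueness of normal
pairs makes every exponent occur once. -/
theorem hilbertSeries3_mul_one_sub {a b c : ℕ} (ha : 0 < a) (hc : 0 < c) (D : Finset (ℕ × ℕ))
    (hD : ∀ p q, (p, q) ∈ D ↔ IsNormalPair a b c p q) :
    hilbertSeries3 a b c * (1 - PowerSeries.X ^ a) =
      ∑ z ∈ D, PowerSeries.X ^ (z.1 * b + z.2 * c) := by
  classical
  ext n
  have hL : PowerSeries.coeff n (hilbertSeries3 a b c * (1 - PowerSeries.X ^ a)) =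
      if n ∈ semigroup3 a b c ∧ ¬ (a ≤ n ∧ n - a ∈ semigroup3 a b c) then 1 else 0 := by
    rw [mul_sub, mul_one, map_sub, PowerSeries.coeff_mul_X_pow']
    simp only [hilbertSeries3, PowerSeries.coeff_mk]
    by_cases h : a ≤ n
    · by_cases h1 : n - a ∈ semigroup3 a b c
      · have h2 : n ∈ semigroup3 a b c := by
          have : a ∈ semigroup3 a b c := AddSubmonoid.subset_closure (by simp)
          simpa [Nat.sub_add_cancel h] using add_mem h1 this
        simp [h, h1, h2]
      · simp [h, h1]
    · simp [h]
  rw [hL, map_sum]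
  simp only [PowerSeries.coeff_X_pow]
  split_ifs with h
  · obtain ⟨p, q, hpq, rfl⟩ := (apery_iff ha).1 h
    rw [Finset.sum_eq_single (p, q)]
    · simp
    · rintro ⟨p', q'⟩ hz hne
      rw [if_neg]
      intro e
      obtain ⟨rfl, rfl⟩ := hpq.unique hc ((hD _ _).1 hz) (by rw [e])
      exact hne rfl
    · intro hn
      exact absurd ((hD _ _).2 hpq) hn
  · symm
    refine Finset.sum_eq_zero fun z hz => if_neg fun e => h ((apery_iff ha).2 ⟨z.1, z.2, (hD _ _).1 hz, e⟩)

theorem sum_rectangle_mul {R : Type*} [CommRing R] (x : R) (b c : ℕ) {P A Q B : ℕ} (hA : P ≤ A)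
    (hB : Q ≤ B) :
    (∑ z ∈ Finset.Ico P A ×ˢ Finset.Ico Q B, x ^ (z.1 * b + z.2 * c)) *
        ((1 - x ^ b) * (1 - x ^ c)) =
      (x ^ (P * b) - x ^ (A * b)) * (x ^ (Q * c) - x ^ (B * c)) := by
  have h1 := geom_sum_Ico_mul_neg (x ^ b) hA
  have h2 := geom_sum_Ico_mul_neg (x ^ c) hB
  have h3 : ∑ z ∈ Finset.Ico P A ×ˢ Finset.Ico Q B, x ^ (z.1 * b + z.2 * c) =
      (∑ i ∈ Finset.Ico P A, (x ^ b) ^ i) * ∑ i ∈ Finset.Ico Q B, (x ^ c) ^ i := by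
    rw [Finset.sum_mul_sum, Finset.sum_product]
    refine Finset.sum_congr rfl fun i _ => Finset.sum_congr rfl fun j _ => ?_
    rw [pow_add, ← pow_mul, ← pow_mul, mul_comm i, mul_comm j]
  rw [h3, mul_comm P, mul_comm A, mul_comm Q, mul_comm B]
  simp only [pow_mul]
  rw [← h1, ← h2]
  ring

/-- The L-shape is a box minus a smaller box. Equality `P = A`, `Q = B` is allowed, so that the full
rectangle is covered too. -/
theorem hilbert_numerator {a b c A B P Q : ℕ} (ha : 0 < a) (hc : 0 < c) (hP : P ≤ A) (hQ : Q ≤ B)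
    (hD : ∀ p q, IsNormalPair a b c p q ↔ p < A ∧ q < B ∧ ¬ (P ≤ p ∧ Q ≤ q)) :
    hilbertSeries3 a b c *
        ((1 - PowerSeries.X ^ a) * (1 - PowerSeries.X ^ b) * (1 - PowerSeries.X ^ c)) =
      (1 - PowerSeries.X ^ (A * b)) * (1 - PowerSeries.X ^ (B * c)) -
        (PowerSeries.X ^ (P * b) - PowerSeries.X ^ (A * b)) *
          (PowerSeries.X ^ (Q * c) - PowerSeries.X ^ (B * c)) := by
  classical
  have hsub : Finset.Ico P A ×ˢ Finset.Ico Q B ⊆ Finset.Ico 0 A ×ˢ Finset.Ico 0 B :=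
    Finset.product_subset_product (Finset.Ico_subset_Ico_left (Nat.zero_le _))
      (Finset.Ico_subset_Ico_left (Nat.zero_le _))
  have h := hilbertSeries3_mul_one_sub ha hc
    ((Finset.Ico 0 A ×ˢ Finset.Ico 0 B) \ (Finset.Ico P A ×ˢ Finset.Ico Q B)) (fun p q => by
      rw [hD]
      simp only [Finset.mem_sdiff, Finset.mem_product, Finset.mem_Ico]
      constructor
      · rintro ⟨⟨⟨-, h1⟩, -, h2⟩, h3⟩
        exact ⟨h1, h2, fun h => h3 ⟨⟨h.1, h1⟩, h.2, h2⟩⟩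
      · rintro ⟨h1, h2, h3⟩
        exact ⟨⟨⟨Nat.zero_le _, h1⟩, Nat.zero_le _, h2⟩, fun h => h3 ⟨h.1.1, h.2.1⟩⟩)
  have hs := Finset.sum_sdiff (f := fun z : ℕ × ℕ =>
    (PowerSeries.X : PowerSeries ℤ) ^ (z.1 * b + z.2 * c)) hsub
  have r1 := sum_rectangle_mul (PowerSeries.X : PowerSeries ℤ) b c (Nat.zero_le A) (Nat.zero_le B)
  have r2 := sum_rectangle_mul (PowerSeries.X : PowerSeries ℤ) b c hP hQ
  rw [zero_mul, zero_mul, pow_zero] at r1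
  rw [← r1, ← r2, ← hs, mul_assoc (1 - PowerSeries.X ^ a), ← mul_assoc, h]
  ring

/-! ### The Frobenius number and the syzygy degrees. -/

theorem mem_semigroup3_of_frobenius3_lt {d₁ d₂ d₃ : ℕ} (hd : IsMinGenTriple d₁ d₂ d₃) {n : ℕ}
    (hn : frobenius3 d₁ d₂ d₃ < n) : n ∈ semigroup3 d₁ d₂ d₃ := by
  by_contra h
  exact absurd (hd.isGreatest_frobenius3.2 h) (by omega)

/-- The largest value of a normal pair is `F₃ + d₁`. -/
theorem exists_normalPair_eq_frobenius3_add {d₁ d₂ d₃ : ℕ} (hd : IsMinGenTriple d₁ d₂ d₃) :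
    ∃ p q, IsNormalPair d₁ d₂ d₃ p q ∧ frobenius3 d₁ d₂ d₃ + d₁ = p * d₂ + q * d₃ := by
  have h3 := hd.three_le
  refine (apery_iff (by omega)).1 ⟨mem_semigroup3_of_frobenius3_lt hd (by omega), fun h => ?_⟩
  rw [Nat.add_sub_cancel] at h
  exact hd.isGreatest_frobenius3.1 h.2

theorem IsNormalPair.le_frobenius3_add {d₁ d₂ d₃ p q : ℕ} (hd : IsMinGenTriple d₁ d₂ d₃)
    (h : IsNormalPair d₁ d₂ d₃ p q) : p * d₂ + q * d₃ ≤ frobenius3 d₁ d₂ d₃ + d₁ := by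
  have h3 := hd.three_le
  by_contra! hlt
  exact ((apery_iff (by omega)).2 ⟨p, q, h, rfl⟩).2
    ⟨by omega, mem_semigroup3_of_frobenius3_lt hd (by omega)⟩

theorem largestSyzygyDegree_of_rectangle {d₁ d₂ d₃ A B : ℕ} (hd : IsMinGenTriple d₁ d₂ d₃)
    (hA : 0 < A) (hB : 0 < B) (hD : ∀ p q, IsNormalPair d₁ d₂ d₃ p q ↔ p < A ∧ q < B) :
    largestSyzygyDegree d₁ d₂ d₃ = A * d₂ + B * d₃ := by
  obtain ⟨p, q, h, e⟩ := exists_normalPair_eq_frobenius3_add hd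
  obtain ⟨hp, hq⟩ := (hD p q).1 h
  have hmax := IsNormalPair.le_frobenius3_add hd ((hD (A - 1) (B - 1)).2 ⟨by omega, by omega⟩)
  have h1 : p * d₂ ≤ (A - 1) * d₂ := Nat.mul_le_mul_right _ (by omega)
  have h2 : q * d₃ ≤ (B - 1) * d₃ := Nat.mul_le_mul_right _ (by omega)
  obtain ⟨A', rfl⟩ := Nat.exists_eq_add_of_lt hA
  obtain ⟨B', rfl⟩ := Nat.exists_eq_add_of_lt hB
  simp only [zero_add, Nat.add_sub_cancel, add_mul, one_mul] at *
  unfold largestSyzygyDegree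
  omega

/-- The maximum over an L-shape is attained at one of the outer corners `(A - 1, Q - 1)`, `(P - 1, B
- 1)`; adding `d₂ + d₃` removes the shifts. Distinct normal pairs have distinct values, so there is
no tie and `y < g₃` holds strictly. -/
theorem largestSyzygyDegree_of_lshape {d₁ d₂ d₃ A B P Q : ℕ} (hd : IsMinGenTriple d₁ d₂ d₃)
    (hP : 0 < P) (hPA : P < A) (hQ : 0 < Q) (hQB : Q < B)
    (hD : ∀ p q, IsNormalPair d₁ d₂ d₃ p q ↔ p < A ∧ q < B ∧ ¬ (P ≤ p ∧ Q ≤ q)) :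
    A * d₂ + Q * d₃ ≠ P * d₂ + B * d₃ ∧
      largestSyzygyDegree d₁ d₂ d₃ = max (A * d₂ + Q * d₃) (P * d₂ + B * d₃) := by
  have hl := hd.three_le
  have hl1 := hd.lt_left
  have hl2 := hd.lt_right
  obtain ⟨p, q, h, e⟩ := exists_normalPair_eq_frobenius3_add hd
  obtain ⟨hp, hq, hpq⟩ := (hD p q).1 h
  have n1 := (hD (A - 1) (Q - 1)).2 ⟨by omega, by omega, by omega⟩
  have n2 := (hD (P - 1) (B - 1)).2 ⟨by omega, by omega, by omega⟩
  have m1 := IsNormalPair.le_frobenius3_add hd n1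
  have m2 := IsNormalPair.le_frobenius3_add hd n2
  have hne : (A - 1) * d₂ + (Q - 1) * d₃ ≠ (P - 1) * d₂ + (B - 1) * d₃ := fun h' => by
    have := n1.unique (by omega) n2 (by rw [h'])
    omega
  have hle : p * d₂ + q * d₃ ≤ (A - 1) * d₂ + (Q - 1) * d₃ ∨
      p * d₂ + q * d₃ ≤ (P - 1) * d₂ + (B - 1) * d₃ := by
    by_cases hc : P ≤ p
    · exact Or.inl (Nat.add_le_add (Nat.mul_le_mul_right _ (by omega))
        (Nat.mul_le_mul_right _ (by omega)))
    · exact Or.inr (Nat.add_le_add (Nat.mul_le_mul_right _ (by omega))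
        (Nat.mul_le_mul_right _ (by omega)))
  clear hD h
  obtain ⟨A', rfl⟩ := Nat.exists_eq_add_of_lt (hP.trans hPA)
  obtain ⟨B', rfl⟩ := Nat.exists_eq_add_of_lt (hQ.trans hQB)
  obtain ⟨P', rfl⟩ := Nat.exists_eq_add_of_lt hP
  obtain ⟨Q', rfl⟩ := Nat.exists_eq_add_of_lt hQ
  simp only [zero_add, Nat.add_sub_cancel, add_mul, one_mul] at m1 m2 hne hle ⊢
  unfold largestSyzygyDegree
  omega

/-- The shape of the syzygy degrees: in the symmetric case the numerator factors, otherwise its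
exponents are given by the sides of an L-shape. -/
theorem exists_isSyzygyDegrees {d₁ d₂ d₃ : ℕ} (hd : IsMinGenTriple d₁ d₂ d₃) :
    (∃ e f : ℕ, 0 < e ∧ 0 < f ∧ largestSyzygyDegree d₁ d₂ d₃ = e + f ∧
        IsSyzygyDegrees d₁ d₂ d₃ e f 0 0) ∨
      ∃ p p' r r' : ℕ, 0 < p ∧ 0 < r ∧ 0 < p' ∧ 0 < r' ∧ r' ≤ p + p' ∧ p' ≤ r + r' ∧
        ((largestSyzygyDegree d₁ d₂ d₃ = p + p' + r ∧ p' > r' ∧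
            IsSyzygyDegrees d₁ d₂ d₃ (p + p') (r + r') (p + r) (p + r + r')) ∨
          (largestSyzygyDegree d₁ d₂ d₃ = p + r + r' ∧ r' > p' ∧
            IsSyzygyDegrees d₁ d₂ d₃ (p + p') (r + r') (p + r) (p + p' + r))) := by
  have hl := hd.three_le
  have hl1 := hd.lt_left
  have hl2 := hd.lt_right
  obtain ⟨A, B, hA, hB, h | ⟨P, Q, hP, hPA, hQ, hQB, h, hBQ, hAP⟩⟩ :=
    IsNormalPair.shape (a := d₁) (b := d₂) (c := d₃) (by omega) (by omega) (by omega)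
  · left
    have hg := largestSyzygyDegree_of_rectangle hd hA hB h
    have hA' : 0 < A * d₂ := Nat.mul_pos hA (by omega)
    have hB' : 0 < B * d₃ := Nat.mul_pos hB (by omega)
    -- Here the numerator is `(1 - t^e) (1 - t^f)`; taking `x₃ = y = 0` adds two cancelling terms.
    refine ⟨A * d₂, B * d₃, hA', hB', hg, ?_, by omega, by omega, by omega, by omega⟩
    rw [hilbert_numerator (by omega) (by omega) le_rfl le_rfl
      (fun p q => (h p q).trans ⟨fun h => ⟨h.1, h.2, by omega⟩, fun h => ⟨h.1, h.2.1⟩⟩), hg]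
    ring
  · right
    obtain ⟨hne, hg⟩ := largestSyzygyDegree_of_lshape hd hP hPA hQ hQB h
    have num := hilbert_numerator (by omega) (by omega) hPA.le hQB.le h
    obtain ⟨i, rfl⟩ := Nat.exists_eq_add_of_lt hPA
    obtain ⟨j, rfl⟩ := Nat.exists_eq_add_of_lt hQB
    have hi : P + i + 1 - P = i + 1 := by omega
    have hj : Q + j + 1 - Q = j + 1 := by omega
    rw [hi] at hAP
    rw [hj] at hBQ
    rw [add_assoc, add_mul P] at *
    rw [add_assoc Q, add_mul Q] at *
    have hp : 0 < P * d₂ := Nat.mul_pos hP (by omega)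
    have hr : 0 < Q * d₃ := Nat.mul_pos hQ (by omega)
    have hp' : 0 < (i + 1) * d₂ := Nat.mul_pos (by omega) (by omega)
    have hr' : 0 < (j + 1) * d₃ := Nat.mul_pos (by omega) (by omega)
    refine ⟨P * d₂, (i + 1) * d₂, Q * d₃, (j + 1) * d₃, hp, hr, hp', hr', hBQ, hAP, ?_⟩
    generalize P * d₂ = p at *
    generalize (i + 1) * d₂ = p' at *
    generalize Q * d₃ = r at *
    generalize (j + 1) * d₃ = r' at *
    rcases lt_or_gt_of_ne (show p' ≠ r' by omega) with hlt | hgt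
    · right
      have hg' : largestSyzygyDegree d₁ d₂ d₃ = p + r + r' := by omega
      refine ⟨hg', hlt, ?_, by omega, by omega, by omega, by omega⟩
      rw [num, hg']
      ring
    · left
      have hg' : largestSyzygyDegree d₁ d₂ d₃ = p + p' + r := by omega
      refine ⟨hg', hgt, ?_, by omega, by omega, by omega, by omega⟩
      rw [num, hg']
      ring

/-! ### Power sums of the syzygy degrees. -/

open PowerSeries in
/-- The difference quotient `(exp (n X) - 1) / X` of the exponential series. -/
noncomputable def expQuotient (n : ℕ) : PowerSeries ℝ :=
  mk fun k => (n : ℝ) ^ (k + 1) / (k + 1).factorial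

theorem coeff_exp_pow (n k : ℕ) :
    PowerSeries.coeff k (PowerSeries.exp ℝ ^ n) = (n : ℝ) ^ k / k.factorial := by
  rw [PowerSeries.exp_pow_eq_rescale_exp]
  simp [PowerSeries.coeff_rescale, div_eq_mul_inv]

theorem exp_pow_eq_one_add (n : ℕ) :
    PowerSeries.exp ℝ ^ n = 1 + PowerSeries.X * expQuotient n := by
  ext k
  rw [coeff_exp_pow]
  rcases k with _ | k
  · simp
  · simp [PowerSeries.coeff_succ_X_mul, expQuotient, PowerSeries.coeff_one]

theorem hilbertSeries3_add_gaps {d₁ d₂ d₃ : ℕ} (hd : IsMinGenTriple d₁ d₂ d₃) :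
    hilbertSeries3 d₁ d₂ d₃ + ∑ s ∈ hd.finite_gaps3.toFinset, PowerSeries.X ^ s =
      PowerSeries.mk 1 := by
  classical
  ext n
  rw [map_add, map_sum]
  simp only [hilbertSeries3, PowerSeries.coeff_X_pow, PowerSeries.coeff_mk, Finset.sum_ite_eq,
    Set.Finite.mem_toFinset, gaps3, Set.mem_ofPred_eq, Pi.one_apply]
  by_cases h : n ∈ semigroup3 d₁ d₂ d₃ <;> simp [h]

/-- Substituting the exponential series in the defining equation of the syzygy degrees. -/
theorem IsSyzygyDegrees.exp_identity {d₁ d₂ d₃ x₁ x₂ x₃ y : ℕ} (hd : IsMinGenTriple d₁ d₂ d₃)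
    (h : IsSyzygyDegrees d₁ d₂ d₃ x₁ x₂ x₃ y) :
    PowerSeries.X ^ 2 * (expQuotient d₁ * expQuotient d₂ * expQuotient d₃ *
        (1 + PowerSeries.X * (expQuotient 1 *
          ∑ s ∈ hd.finite_gaps3.toFinset, PowerSeries.exp ℝ ^ s))) =
      expQuotient 1 * (1 - PowerSeries.exp ℝ ^ x₁ - PowerSeries.exp ℝ ^ x₂ -
        PowerSeries.exp ℝ ^ x₃ + PowerSeries.exp ℝ ^ y +
        PowerSeries.exp ℝ ^ largestSyzygyDegree d₁ d₂ d₃) := by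
  -- The exponential has constant term `1` and cannot be substituted into a general power series.
  -- Multiplying by `1 - X` and writing the Hilbert series through the finite gap set gives a
  -- polynomial identity, where it can.
  have hpoly : (1 - (1 - Polynomial.X) * ∑ s ∈ hd.finite_gaps3.toFinset, Polynomial.X ^ s) *
      ((1 - Polynomial.X ^ d₁) * (1 - Polynomial.X ^ d₂) * (1 - Polynomial.X ^ d₃)) =
      (1 - Polynomial.X) * (1 - Polynomial.X ^ x₁ - Polynomial.X ^ x₂ - Polynomial.X ^ x₃ +
        Polynomial.X ^ y + Polynomial.X ^ largestSyzygyDegree d₁ d₂ d₃ : Polynomial ℤ) := by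
    have hG := hilbertSeries3_add_gaps hd
    have h1 := PowerSeries.mk_one_mul_one_sub_eq_one ℤ
    have hco : ∀ T : Finset ℕ, ((∑ s ∈ T, Polynomial.X ^ s : Polynomial ℤ) : PowerSeries ℤ) =
        ∑ s ∈ T, PowerSeries.X ^ s := fun T => by
      rw [← Polynomial.coeToPowerSeries.ringHom_apply, map_sum]
      simp
    apply Polynomial.coe_injective
    push_cast
    rw [hco, ← h.hilbert_eq]
    rw [← hG] at h1
    linear_combination (-(1 - PowerSeries.X ^ d₁) * (1 - PowerSeries.X ^ d₂) *
      (1 - PowerSeries.X ^ d₃)) * h1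
  have hexp := congrArg (Polynomial.aeval (PowerSeries.exp ℝ)) hpoly
  simp only [map_mul, map_sub, map_add, map_one, map_pow, map_sum, Polynomial.aeval_X] at hexp
  have e0 := exp_pow_eq_one_add 1
  rw [pow_one] at e0
  have e1 := exp_pow_eq_one_add d₁
  have e2 := exp_pow_eq_one_add d₂
  have e3 := exp_pow_eq_one_add d₃
  have hX : (PowerSeries.X : PowerSeries ℝ) ≠ 0 := PowerSeries.X_ne_zero
  apply mul_left_cancel₀ hX
  generalize hS : ∑ s ∈ hd.finite_gaps3.toFinset, PowerSeries.exp ℝ ^ s = Φ at *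
  generalize hQ : (1 - PowerSeries.exp ℝ ^ x₁ - PowerSeries.exp ℝ ^ x₂ -
        PowerSeries.exp ℝ ^ x₃ + PowerSeries.exp ℝ ^ y +
        PowerSeries.exp ℝ ^ largestSyzygyDegree d₁ d₂ d₃) = Q at *
  rw [e1, e2, e3, e0] at hexp
  linear_combination -hexp

theorem coeff_sum_exp_pow {d₁ d₂ d₃ : ℕ} (hd : IsMinGenTriple d₁ d₂ d₃) (k : ℕ) :
    PowerSeries.coeff k (∑ s ∈ hd.finite_gaps3.toFinset, PowerSeries.exp ℝ ^ s) =
      genus3 k d₁ d₂ d₃ / k.factorial := by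
  rw [map_sum]
  simp only [coeff_exp_pow]
  rw [← Finset.sum_div, genus3, finsum_mem_eq_finite_toFinset_sum _ hd.finite_gaps3]

theorem coeff_mul_low {R : Type*} [CommRing R] (f g : PowerSeries R) :
    PowerSeries.coeff 0 (f * g) = PowerSeries.coeff 0 f * PowerSeries.coeff 0 g ∧
    PowerSeries.coeff 1 (f * g) = PowerSeries.coeff 0 f * PowerSeries.coeff 1 g +
      PowerSeries.coeff 1 f * PowerSeries.coeff 0 g ∧
    PowerSeries.coeff 2 (f * g) = PowerSeries.coeff 0 f * PowerSeries.coeff 2 g +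
      PowerSeries.coeff 1 f * PowerSeries.coeff 1 g +
      PowerSeries.coeff 2 f * PowerSeries.coeff 0 g ∧
    PowerSeries.coeff 3 (f * g) = PowerSeries.coeff 0 f * PowerSeries.coeff 3 g +
      PowerSeries.coeff 1 f * PowerSeries.coeff 2 g +
      PowerSeries.coeff 2 f * PowerSeries.coeff 1 g +
      PowerSeries.coeff 3 f * PowerSeries.coeff 0 g ∧
    PowerSeries.coeff 4 (f * g) = PowerSeries.coeff 0 f * PowerSeries.coeff 4 g +
      PowerSeries.coeff 1 f * PowerSeries.coeff 3 g +
      PowerSeries.coeff 2 f * PowerSeries.coeff 2 g +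
      PowerSeries.coeff 3 f * PowerSeries.coeff 1 g +
      PowerSeries.coeff 4 f * PowerSeries.coeff 0 g ∧
    PowerSeries.coeff 5 (f * g) = PowerSeries.coeff 0 f * PowerSeries.coeff 5 g +
      PowerSeries.coeff 1 f * PowerSeries.coeff 4 g +
      PowerSeries.coeff 2 f * PowerSeries.coeff 3 g +
      PowerSeries.coeff 3 f * PowerSeries.coeff 2 g +
      PowerSeries.coeff 4 f * PowerSeries.coeff 1 g +
      PowerSeries.coeff 5 f * PowerSeries.coeff 0 g ∧
    PowerSeries.coeff 6 (f * g) = PowerSeries.coeff 0 f * PowerSeries.coeff 6 g +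
      PowerSeries.coeff 1 f * PowerSeries.coeff 5 g +
      PowerSeries.coeff 2 f * PowerSeries.coeff 4 g +
      PowerSeries.coeff 3 f * PowerSeries.coeff 3 g +
      PowerSeries.coeff 4 f * PowerSeries.coeff 2 g +
      PowerSeries.coeff 5 f * PowerSeries.coeff 1 g +
      PowerSeries.coeff 6 f * PowerSeries.coeff 0 g := by
  refine ⟨?_, ?_, ?_, ?_, ?_, ?_, ?_⟩ <;>
    rw [PowerSeries.coeff_mul, Finset.Nat.sum_antidiagonal_eq_sum_range_succ_mk] <;>
    simp only [Finset.sum_range_succ, Finset.sum_range_zero, zero_add]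

/-- The power sum identities satisfied by the syzygy degrees. -/
theorem IsSyzygyDegrees.power_sums {d₁ d₂ d₃ x₁ x₂ x₃ y : ℕ} (hd : IsMinGenTriple d₁ d₂ d₃)
    (h : IsSyzygyDegrees d₁ d₂ d₃ x₁ x₂ x₃ y) {g : ℝ}
    (hg : g = largestSyzygyDegree d₁ d₂ d₃) :
    (y : ℝ) + g - (x₁ + x₂ + x₃) = 0 ∧
    (y : ℝ) ^ 2 + g ^ 2 - (x₁ ^ 2 + x₂ ^ 2 + x₃ ^ 2) = 2 * (d₁ * d₂ * d₃) ∧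
    (y : ℝ) ^ 3 + g ^ 3 - (x₁ ^ 3 + x₂ ^ 3 + x₃ ^ 3) = 6 * (d₁ * d₂ * d₃) * coeffK0 d₁ d₂ d₃ ∧
    (y : ℝ) ^ 4 + g ^ 4 - (x₁ ^ 4 + x₂ ^ 4 + x₃ ^ 4) = 24 * (d₁ * d₂ * d₃) * coeffK1 d₁ d₂ d₃ ∧
    (y : ℝ) ^ 6 + g ^ 6 - (x₁ ^ 6 + x₂ ^ 6 + x₃ ^ 6) =
      120 * (d₁ * d₂ * d₃) * coeffK3 d₁ d₂ d₃ := by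
  have key := h.exp_identity hd
  have hΦ := coeff_sum_exp_pow hd
  generalize ∑ s ∈ hd.finite_gaps3.toFinset, PowerSeries.exp ℝ ^ s = Φ at key hΦ
  have hQ : ∀ k, PowerSeries.coeff k (1 - PowerSeries.exp ℝ ^ x₁ - PowerSeries.exp ℝ ^ x₂ -
        PowerSeries.exp ℝ ^ x₃ + PowerSeries.exp ℝ ^ y +
        PowerSeries.exp ℝ ^ largestSyzygyDegree d₁ d₂ d₃) =
      ((if k = 0 then 1 else 0) + (y : ℝ) ^ k + g ^ k - ((x₁ : ℝ) ^ k + x₂ ^ k + x₃ ^ k)) /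
        k.factorial := fun k => by
    simp only [map_add, map_sub, coeff_exp_pow, PowerSeries.coeff_one, ← hg]
    split_ifs with hk
    · subst hk; simp
    · ring
  generalize (1 - PowerSeries.exp ℝ ^ x₁ - PowerSeries.exp ℝ ^ x₂ -
        PowerSeries.exp ℝ ^ x₃ + PowerSeries.exp ℝ ^ y +
        PowerSeries.exp ℝ ^ largestSyzygyDegree d₁ d₂ d₃) = Q at key hQ
  have hA : ∀ n k, PowerSeries.coeff k (expQuotient n) = (n : ℝ) ^ (k + 1) / (k + 1).factorial :=
    fun n k => by simp [expQuotient]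
  obtain ⟨a0, a1, a2, a3, a4, -, -⟩ := coeff_mul_low (expQuotient d₁) (expQuotient d₂)
  obtain ⟨b0, b1, b2, b3, b4, -, -⟩ :=
    coeff_mul_low (expQuotient d₁ * expQuotient d₂) (expQuotient d₃)
  obtain ⟨c0, c1, c2, c3, -, -, -⟩ := coeff_mul_low (expQuotient 1) Φ
  have u0 : PowerSeries.coeff 0 (1 + PowerSeries.X * (expQuotient 1 * Φ)) = 1 := by simp
  have u : ∀ k, PowerSeries.coeff (k + 1) (1 + PowerSeries.X * (expQuotient 1 * Φ)) =
      PowerSeries.coeff k (expQuotient 1 * Φ) := fun k => by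
    simp [PowerSeries.coeff_succ_X_mul, PowerSeries.coeff_one]
  obtain ⟨t0, t1, t2, t3, t4, -, -⟩ := coeff_mul_low
    (expQuotient d₁ * expQuotient d₂ * expQuotient d₃) (1 + PowerSeries.X * (expQuotient 1 * Φ))
  obtain ⟨q0, q1, q2, q3, q4, q5, q6⟩ := coeff_mul_low (expQuotient 1) Q
  rw [← key] at q0 q1 q2 q3 q4 q5 q6
  rw [u0] at t0 t1 t2 t3 t4
  have u1 := u 0
  have u2 := u 1
  have u3 := u 2
  have u4 := u 3
  norm_num only at u1 u2 u3 u4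
  have w : ∀ (k : ℕ) (f : PowerSeries ℝ),
      PowerSeries.coeff (k + 2) (PowerSeries.X ^ 2 * f) = PowerSeries.coeff k f := fun k f => by
    rw [PowerSeries.coeff_X_pow_mul]
  have w0 := w 0
  have w1 := w 1
  have w2 := w 2
  have w3 := w 3
  have w4 := w 4
  norm_num only at w0 w1 w2 w3 w4
  rw [PowerSeries.coeff_X_pow_mul', if_neg (by norm_num)] at q0 q1
  rw [w0, t0] at q2
  rw [w1, t1] at q3
  rw [w2, t2] at q4
  rw [w3, t3] at q5
  rw [w4, t4] at q6
  rw [u1, u2, u3, u4, c0, c1, c2, c3, b0, b1, b2, b3, b4, a0, a1, a2, a3, a4] at q6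
  rw [u1, u2, u3, c0, c1, c2, b0, b1, b2, b3, a0, a1, a2, a3] at q5
  rw [u1, u2, c0, c1, b0, b1, b2, a0, a1, a2] at q4
  rw [u1, c0, b0, b1, a0, a1] at q3
  rw [b0, a0] at q2
  simp only [hQ, hA, hΦ] at q0 q1 q2 q3 q4 q5 q6
  clear a0 a1 a2 a3 a4 b0 b1 b2 b3 b4 c0 c1 c2 c3 t0 t1 t2 t3 t4 u0 u u1 u2 u3 u4 w w0 w1 w2 w3 w4
    hQ hA hΦ key h
  simp only [Nat.factorial, Nat.cast_one, one_pow, if_true, if_false, OfNat.ofNat_ne_zero,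
    one_ne_zero, pow_zero, zero_add, Nat.succ_eq_add_one, Nat.reduceAdd, Nat.reduceMul,
    Nat.cast_ofNat, pow_one] at q0 q1 q2 q3 q4 q5 q6
  unfold coeffK0 coeffK1 coeffK3 delta3 sigma3
  -- The coefficients below undo the factor `(exp X - 1) / X`: up to sign they are `k!` times those
  -- of `X / (exp X - 1) = 1 - X/2 + X²/12 - X⁴/720 + ⋯`.
  refine ⟨?_, ?_, ?_, ?_, ?_⟩
  · linear_combination -q1
  · linear_combination -2 * q2 + q1
  · linear_combination -6 * q3 + 3 * q2 - (1 / 2) * q1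
  · linear_combination -24 * q4 + 12 * q3 - 2 * q2
  · linear_combination -720 * q6 + 360 * q5 - 60 * q4 + q2

/-! ### Elimination of the three degrees `xⱼ`. -/

/-- Newton's identity for three variables, `hn`, removes the `xⱼ`; the result is divisible by `π`.
-/
theorem degree_four_relation {x₁ x₂ x₃ y g π K₀ K₁ : ℝ} (hπ : π ≠ 0)
    (h1 : y + g - (x₁ + x₂ + x₃) = 0)
    (h2 : y ^ 2 + g ^ 2 - (x₁ ^ 2 + x₂ ^ 2 + x₃ ^ 2) = 2 * π)
    (h3 : y ^ 3 + g ^ 3 - (x₁ ^ 3 + x₂ ^ 3 + x₃ ^ 3) = 6 * π * K₀)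
    (h4 : y ^ 4 + g ^ 4 - (x₁ ^ 4 + x₂ ^ 4 + x₃ ^ 4) = 24 * π * K₁) :
    1 / 2 * (2 * K₀ - g) * (y - 2 * K₀) = 3 * K₁ - 2 * K₀ ^ 2 + π / 4 := by
  have e1 : x₁ + x₂ + x₃ = y + g := by linear_combination -h1
  have e2 : x₁ ^ 2 + x₂ ^ 2 + x₃ ^ 2 = y ^ 2 + g ^ 2 - 2 * π := by linear_combination -h2
  have e3 : x₁ ^ 3 + x₂ ^ 3 + x₃ ^ 3 = y ^ 3 + g ^ 3 - 6 * π * K₀ := by linear_combination -h3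
  have hn : x₁ ^ 4 + x₂ ^ 4 + x₃ ^ 4 = ((x₁ + x₂ + x₃) ^ 4
      - 6 * (x₁ + x₂ + x₃) ^ 2 * (x₁ ^ 2 + x₂ ^ 2 + x₃ ^ 2) + 3 * (x₁ ^ 2 + x₂ ^ 2 + x₃ ^ 2) ^ 2
      + 8 * (x₁ + x₂ + x₃) * (x₁ ^ 3 + x₂ ^ 3 + x₃ ^ 3)) / 6 := by ring
  rw [e1, e2, e3] at hn
  apply mul_left_cancel₀ hπ
  linear_combination (1 / 8) * h4 + (1 / 8) * hn

theorem degree_six_relation {x₁ x₂ x₃ y g π K₀ K₁ K₃ : ℝ} (hπ : π ≠ 0)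
    (h1 : y + g - (x₁ + x₂ + x₃) = 0)
    (h2 : y ^ 2 + g ^ 2 - (x₁ ^ 2 + x₂ ^ 2 + x₃ ^ 2) = 2 * π)
    (h3 : y ^ 3 + g ^ 3 - (x₁ ^ 3 + x₂ ^ 3 + x₃ ^ 3) = 6 * π * K₀)
    (h4 : y ^ 4 + g ^ 4 - (x₁ ^ 4 + x₂ ^ 4 + x₃ ^ 4) = 24 * π * K₁)
    (h6 : y ^ 6 + g ^ 6 - (x₁ ^ 6 + x₂ ^ 6 + x₃ ^ 6) = 120 * π * K₃) :
    10 * K₃ = 18 * K₁ ^ 2 - π * K₀ ^ 2 + π ^ 2 / 24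
      + (y + g) ^ 2 * (1 / 2 * (2 * K₀ - g) * (y - 2 * K₀)) := by
  -- `K₁` does not enter the sixth power sum, so it is first eliminated by the degree-four relation.
  have hK : K₁ = (1 / 2 * (2 * K₀ - g) * (y - 2 * K₀) + 2 * K₀ ^ 2 - π / 4) / 3 := by
    linear_combination -(1 / 3) * degree_four_relation hπ h1 h2 h3 h4
  have e1 : x₁ + x₂ + x₃ = y + g := by linear_combination -h1
  have e2 : x₁ ^ 2 + x₂ ^ 2 + x₃ ^ 2 = y ^ 2 + g ^ 2 - 2 * π := by linear_combination -h2
  have e3 : x₁ ^ 3 + x₂ ^ 3 + x₃ ^ 3 = y ^ 3 + g ^ 3 - 6 * π * K₀ := by linear_combination -h3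
  have hn : x₁ ^ 6 + x₂ ^ 6 + x₃ ^ 6 = ((x₁ + x₂ + x₃) ^ 6
      - 3 * (x₁ + x₂ + x₃) ^ 4 * (x₁ ^ 2 + x₂ ^ 2 + x₃ ^ 2)
      - 9 * (x₁ + x₂ + x₃) ^ 2 * (x₁ ^ 2 + x₂ ^ 2 + x₃ ^ 2) ^ 2
      + 3 * (x₁ ^ 2 + x₂ ^ 2 + x₃ ^ 2) ^ 3
      + 4 * (x₁ + x₂ + x₃) ^ 3 * (x₁ ^ 3 + x₂ ^ 3 + x₃ ^ 3)
      + 12 * (x₁ + x₂ + x₃) * (x₁ ^ 2 + x₂ ^ 2 + x₃ ^ 2) * (x₁ ^ 3 + x₂ ^ 3 + x₃ ^ 3)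
      + 4 * (x₁ ^ 3 + x₂ ^ 3 + x₃ ^ 3) ^ 2) / 12 := by ring
  rw [e1, e2, e3] at hn
  apply mul_left_cancel₀ hπ
  rw [hK]
  linear_combination -(1 / 12) * h6 - (1 / 12) * hn

/-! ### Bounds for the sixth power sum and for `h₃`. -/

theorem rectangle_bounds {e f : ℝ} (he : 0 < e) (hf : 0 < f) :
    3 * (e * f) * (e + f) ^ 4 < (e + f) ^ 6 - (e ^ 6 + f ^ 6) ∧
      (e + f) ^ 6 - (e ^ 6 + f ^ 6) < 9 * (e * f) * (e + f) ^ 4 := by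
  constructor
  · rw [← sub_pos]
    ring_nf
    positivity
  · rw [← sub_pos]
    ring_nf
    positivity

theorem lshape_bounds {p p' r r' : ℝ} (hp : 0 < p) (hr : 0 < r) (hp' : 0 < p') (h : p' ≤ r')
    (hle : r' ≤ p + p') :
    3 * (p * r + p * r' + p' * r) * (p + r + r') ^ 4 < (p + p' + r) ^ 6 + (p + r + r') ^ 6 -
        ((p + p') ^ 6 + (r + r') ^ 6 + (p + r) ^ 6) ∧
      (p + p' + r) ^ 6 + (p + r + r') ^ 6 - ((p + p') ^ 6 + (r + r') ^ 6 + (p + r) ^ 6) <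
        9 * (p * r + p * r' + p' * r) * (p + r + r') ^ 4 := by
  -- The slacks `n = r' - p'` and `k = p + p' - r'` of the two hypotheses serve as variables; in
  -- `n`, `k`, `p'`, `r` the differences have no negative coefficients.
  obtain ⟨n, hn, rfl⟩ : ∃ n, 0 ≤ n ∧ r' = p' + n := ⟨r' - p', by linarith, by ring⟩
  obtain ⟨k, hk, rfl⟩ : ∃ k, 0 ≤ k ∧ p = k + n := ⟨p - n, by linarith, by ring⟩
  constructor
  · rcases hk.eq_or_lt with rfl | hk'
    · rw [zero_add] at *
      rw [← sub_pos]
      ring_nf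
      positivity
    · rw [← sub_pos]
      ring_nf
      positivity
  · rcases hk.eq_or_lt with rfl | hk'
    · rw [zero_add] at *
      rw [← sub_pos]
      ring_nf
      positivity
    · rw [← sub_pos]
      ring_nf
      positivity

theorem IsMinGenTriple.prod_pos {d₁ d₂ d₃ : ℕ} (hd : IsMinGenTriple d₁ d₂ d₃) :
    (0 : ℝ) < d₁ * d₂ * d₃ := by
  have h1 := hd.three_le
  have h2 := hd.lt_left
  have h3 := hd.lt_right
  have e1 : (0 : ℝ) < d₁ := Nat.cast_pos.2 (by omega)
  have e2 : (0 : ℝ) < d₂ := Nat.cast_pos.2 (by omega)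
  have e3 : (0 : ℝ) < d₃ := Nat.cast_pos.2 (by omega)
  positivity

/-- Both relations are homogeneous, of weights two and four, so they are divided by `g₃²` and `g₃⁴`;
here `y = (u - 1) g₃`. -/
theorem IsSyzygyDegrees.rescaled_identities {d₁ d₂ d₃ x₁ x₂ x₃ y : ℕ}
    (hd : IsMinGenTriple d₁ d₂ d₃) (h : IsSyzygyDegrees d₁ d₂ d₃ x₁ x₂ x₃ y) :
    Delta1 d₁ d₂ d₃ y =
        3 * rescaledGenus1 d₁ d₂ d₃ - 2 * rescaledGenus0 d₁ d₂ d₃ ^ 2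
          + rescaledProd d₁ d₂ d₃ / 4 ∧
      10 * rescaledGenus3 d₁ d₂ d₃ =
        18 * rescaledGenus1 d₁ d₂ d₃ ^ 2
          - rescaledProd d₁ d₂ d₃ * rescaledGenus0 d₁ d₂ d₃ ^ 2
          + rescaledProd d₁ d₂ d₃ ^ 2 / 24
          + syzygyRatio d₁ d₂ d₃ y ^ 2 * Delta1 d₁ d₂ d₃ y := by
  obtain ⟨h1, h2, h3, h4, h6⟩ := h.power_sums hd rfl
  have hπ := hd.prod_pos.ne'
  have hg : (largestSyzygyDegree d₁ d₂ d₃ : ℝ) ≠ 0 :=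
    Nat.cast_ne_zero.2 (Nat.zero_le y |>.trans_lt h.y_lt).ne'
  have r4 := degree_four_relation hπ h1 h2 h3 h4
  have r6 := degree_six_relation hπ h1 h2 h3 h4 h6
  unfold Delta1 rescaledGenus0 rescaledGenus1 rescaledGenus3 rescaledProd syzygyRatio
  generalize (largestSyzygyDegree d₁ d₂ d₃ : ℝ) = g at *
  constructor
  · calc _ = (1 / 2 * (2 * coeffK0 d₁ d₂ d₃ - g) * (y - 2 * coeffK0 d₁ d₂ d₃)) / g ^ 2 := by
          field_simp
          ring
      _ = _ := by
          rw [r4]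
          field_simp
  · calc _ = (10 * coeffK3 d₁ d₂ d₃) / g ^ 4 := by ring
      _ = _ := by
          rw [r6]
          field_simp
          ring

/-- Bounds on the sixth power sum of the syzygy degrees are bounds on `h₃`. -/
theorem IsSyzygyDegrees.rescaledGenus3_mem_Ioo {d₁ d₂ d₃ x₁ x₂ x₃ y : ℕ} (hd : IsMinGenTriple d₁ d₂ d₃)
    (h : IsSyzygyDegrees d₁ d₂ d₃ x₁ x₂ x₃ y) {π g : ℝ}
    (hg : (largestSyzygyDegree d₁ d₂ d₃ : ℝ) = g)
    (hπ : (y : ℝ) ^ 2 + g ^ 2 - (x₁ ^ 2 + x₂ ^ 2 + x₃ ^ 2) = 2 * π)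
    (hlow : 3 * π * g ^ 4 < (y : ℝ) ^ 6 + g ^ 6 - (x₁ ^ 6 + x₂ ^ 6 + x₃ ^ 6))
    (hup : (y : ℝ) ^ 6 + g ^ 6 - (x₁ ^ 6 + x₂ ^ 6 + x₃ ^ 6) < 9 * π * g ^ 4) :
    rescaledGenus3 d₁ d₂ d₃ ∈ Set.Ioo (3 / 120) (9 / 120) := by
  obtain ⟨-, h2, -, -, h6⟩ := h.power_sums hd hg.symm
  have hπ' : π = d₁ * d₂ * d₃ := by linarith
  have hpos : 0 < π := hπ' ▸ hd.prod_pos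
  have hg0 : 0 < g := by
    rw [← hg]
    exact Nat.cast_pos.2 ((Nat.zero_le y).trans_lt h.y_lt)
  have hg4 : 0 < g ^ 4 := by positivity
  rw [h6, ← hπ'] at hlow hup
  unfold rescaledGenus3
  rw [hg]
  constructor
  · rw [lt_div_iff₀ hg4]
    refine lt_of_mul_lt_mul_left ?_ hpos.le
    linarith
  · rw [div_lt_iff₀ hg4]
    refine lt_of_mul_lt_mul_left ?_ hpos.le
    linarith

theorem IsMinGenTriple.rescaledGenus3_mem_Ioo {d₁ d₂ d₃ : ℕ} (hd : IsMinGenTriple d₁ d₂ d₃) :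
    rescaledGenus3 d₁ d₂ d₃ ∈ Set.Ioo (3 / 120) (9 / 120) := by
  rcases exists_isSyzygyDegrees hd with ⟨e, f, he, hf, hg, h⟩ |
    ⟨p, p', r, r', hp, hr, hp', hr', hle, hle', ⟨hg, hlt, h⟩ | ⟨hg, hlt, h⟩⟩
  · have hg' : (largestSyzygyDegree d₁ d₂ d₃ : ℝ) = e + f := by rw [hg]; push_cast; rfl
    obtain ⟨hl, hu⟩ := rectangle_bounds (Nat.cast_pos (α := ℝ).2 he) (Nat.cast_pos (α := ℝ).2 hf)
    refine h.rescaledGenus3_mem_Ioo hd (π := e * f) hg' ?_ ?_ ?_ <;>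
      push_cast <;> linarith
  · have hg' : (largestSyzygyDegree d₁ d₂ d₃ : ℝ) = p + p' + r := by rw [hg]; push_cast; rfl
    -- The other corner is the larger one, so the two axes exchange roles.
    obtain ⟨hl, hu⟩ := lshape_bounds (Nat.cast_pos (α := ℝ).2 hr) (Nat.cast_pos (α := ℝ).2 hp)
      (Nat.cast_pos (α := ℝ).2 hr') (Nat.cast_le (α := ℝ).2 hlt.le) (by exact_mod_cast hle')
    refine h.rescaledGenus3_mem_Ioo hd (π := r * p + r * p' + r' * p) hg' ?_ ?_ ?_
    · push_cast; ring
    · push_cast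
      refine lt_of_eq_of_lt ?_ (lt_of_lt_of_eq hl ?_) <;> ring
    · push_cast
      refine lt_of_eq_of_lt ?_ (lt_of_lt_of_eq hu ?_) <;> ring
  · have hg' : (largestSyzygyDegree d₁ d₂ d₃ : ℝ) = p + r + r' := by rw [hg]; push_cast; rfl
    obtain ⟨hl, hu⟩ := lshape_bounds (Nat.cast_pos (α := ℝ).2 hp) (Nat.cast_pos (α := ℝ).2 hr)
      (Nat.cast_pos (α := ℝ).2 hp') (Nat.cast_le (α := ℝ).2 hlt.le) (by exact_mod_cast hle)
    refine h.rescaledGenus3_mem_Ioo hd (π := p * r + p * r' + p' * r) hg' ?_ ?_ ?_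
    · push_cast; ring
    · push_cast
      refine lt_of_eq_of_lt ?_ (lt_of_lt_of_eq hl ?_) <;> ring
    · push_cast
      refine lt_of_eq_of_lt ?_ (lt_of_lt_of_eq hu ?_) <;> ring

theorem mainTheorem5 (d₁ d₂ d₃ : ℕ) (hd : IsMinGenTriple d₁ d₂ d₃) :
    (∃ x₁ x₂ x₃ y : ℕ, IsSyzygyDegrees d₁ d₂ d₃ x₁ x₂ x₃ y) ∧
    (∀ x₁ x₂ x₃ y : ℕ, IsSyzygyDegrees d₁ d₂ d₃ x₁ x₂ x₃ y →
      Delta1 d₁ d₂ d₃ y =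
          3 * rescaledGenus1 d₁ d₂ d₃ - 2 * rescaledGenus0 d₁ d₂ d₃ ^ 2
            + rescaledProd d₁ d₂ d₃ / 4 ∧
      10 * rescaledGenus3 d₁ d₂ d₃ =
          18 * rescaledGenus1 d₁ d₂ d₃ ^ 2
            - rescaledProd d₁ d₂ d₃ * rescaledGenus0 d₁ d₂ d₃ ^ 2
            + rescaledProd d₁ d₂ d₃ ^ 2 / 24
            + syzygyRatio d₁ d₂ d₃ y ^ 2 * Delta1 d₁ d₂ d₃ y) ∧
    0.02443 < rescaledGenus3 d₁ d₂ d₃ ∧ rescaledGenus3 d₁ d₂ d₃ < 0.07515 := by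
  refine ⟨?_, fun x₁ x₂ x₃ y h => h.rescaled_identities hd, ?_⟩
  · rcases exists_isSyzygyDegrees hd with ⟨e, f, -, -, -, h⟩ |
      ⟨p, p', r, r', -, -, -, -, -, -, ⟨-, -, h⟩ | ⟨-, -, h⟩⟩
    · exact ⟨_, _, _, _, h⟩
    · exact ⟨_, _, _, _, h⟩
    · exact ⟨_, _, _, _, h⟩
  · obtain ⟨hl, hu⟩ := hd.rescaledGenus3_mem_Ioo
    constructor
    · refine lt_trans ?_ hl
      norm_num
    · refine hu.trans ?_
      norm_num
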